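/- Let $X\subset\mathbb{R}^d$ be compact, and let $P,Q,\mu$ be probability distributions on $X$ with densities $p,q,m$ with respect to Lebesgue measure, where $m(x)>0$ for all $x\in X$ (so that $\mu$ dominates $P$ and $Q$). Let $W^{1,2}(X,\mu)$ be the set of functions $f$ on $X$ that have a weak gradient $\nabla f$ in the interior of $X$ with $\int_X\|\nabla f\|^2\,d\mu<\infty$, and let $W^{1,2}_0(X,\mu)$ be the set of those vanishing at the boundary, i.e. those $f$ for which there are smooth functions $\varphi_n$ with compact support in the interior of $X$ such that $\varphi_n\to f$ and $\nabla\varphi_n\to\nabla f$ in $L^2(X,\mu)$. (Integrals involving gradients are taken over the interior of $X$.) Write $$\langle f,g\rangle_{W^{1,2}_0}=\int_X\langle\nabla f,\nabla g\rangle\,d\mu,\qquad \|f\|_{W^{1,2}_0}=\langle f,f\rangle_{W^{1,2}_0}^{1/2}.$$ Let $\mathcal{C}$ be the set of all critics, i.e. of all $f\in W^{1,2}_0(X,\mu)$ for which the expectations $\mathbb{E}_{x\sim P}f(x)$ and $\mathbb{E}_{x\sim Q}f(x)$ exist (are finite). For a set $\mathcal{H}\subseteq\mathcal{C}$ define the restricted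 Sobolev IPM $$\mathcal{S}_{\mathcal{H},\mu}(P,Q)=\sup_{f\in\mathcal{H},\ \|f\|_{W^{1,2}_0}\le 1}\Big\{\mathbb{E}_{x\sim P}f(x)-\mathbb{E}_{x\sim Q}f(x)\Big\},$$ and let $\mathcal{S}_\mu(P,Q)=\mathcal{S}_{\mathcal{C},\mu}(P,Q)$ be the Sobolev IPM. Let $f^*\in\mathcal{C}$, $\|f^*\|_{W^{1,2}_0}\le 1$, be an optimal critic, i.e. $\mathbb{E}_{x\sim P}f^*(x)-\mathbb{E}_{x\sim Q}f^*(x)=\mathcal{S}_\mu(P,Q)$. Then for every hypothesis class $\mathcal{H}\subseteq\mathcal{C}$ that contains at least one $f$ with $\|f\|_{W^{1,2}_0}\le 1$, $$\mathcal{S}_{\mathcal{H},\mu}(P,Q)=\mathcal{S}_\mu(P,Q)\ \sup_{f\in\mathcal{H},\ \|f\|_{W^{1,2}_0}\le 1}\langle f,f^*\rangle_{W^{1,2}_0}.$$ -/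

import Mathlib

open MeasureTheory Set Filter Topology
open scoped ContDiff

namespace SobolevIPM

noncomputable section

/-- `p` is a probability density on `X ⊆ ℝ^d` with respect to Lebesgue measure. -/
structure IsDensity {d : ℕ} (X : Set (EuclideanSpace ℝ (Fin d)))
    (p : EuclideanSpace ℝ (Fin d) → ℝ) : Prop where
  measurable : Measurable p
  nonneg : ∀ x ∈ X, 0 ≤ p x
  lintegral_eq_one : ∫⁻ x in X, ENNReal.ofReal (p x) = 1

/-- The distribution `p(x) dx` on `X`. -/
def law {d : ℕ} (X : Set (EuclideanSpace ℝ (Fin d))) (p : EuclideanSpace ℝ (Fin d) → ℝ) :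
    Measure (EuclideanSpace ℝ (Fin d)) :=
  (volume.restrict X).withDensity (fun x => ENNReal.ofReal (p x))

/-- Test functions: smooth functions with compact support contained in `U`. -/
def IsTestFunction {d : ℕ} (U : Set (EuclideanSpace ℝ (Fin d)))
    (φ : EuclideanSpace ℝ (Fin d) → ℝ) : Prop :=
  ContDiff ℝ ∞ φ ∧ HasCompactSupport φ ∧ tsupport φ ⊆ U

/-- `g` is a weak (distributional) gradient of `f` on the open set `U`. -/
structure HasWeakGradient {d : ℕ} (U : Set (EuclideanSpace ℝ (Fin d)))
    (f : EuclideanSpace ℝ (Fin d) → ℝ)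
    (g : EuclideanSpace ℝ (Fin d) → EuclideanSpace ℝ (Fin d)) : Prop where
  locallyIntegrableOn : LocallyIntegrableOn f U
  locallyIntegrableOn_gradient : LocallyIntegrableOn g U
  integral_eq : ∀ φ : EuclideanSpace ℝ (Fin d) → ℝ, IsTestFunction U φ →
    ∫ x in U, f x • gradient φ x = -∫ x in U, φ x • g x

open Classical in
/-- The weak gradient of `f` on `U` (unique up to Lebesgue null sets in `U`; it is only ever
used on `U`, and for functions which have a weak gradient). -/
def weakGradient {d : ℕ} (U : Set (EuclideanSpace ℝ (Fin d)))
    (f : EuclideanSpace ℝ (Fin d) → ℝ) : EuclideanSpace ℝ (Fin d) → EuclideanSpace ℝ (Fin d) :=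
  if h : ∃ g, HasWeakGradient U f g then h.choose else 0

/-- `W^{1,2}(X, μ)`, `μ = m(x) dx`: (measurable) functions on `X`, weakly differentiable in the
interior of `X`, with `∫ ‖∇f‖² dμ < ∞`. -/
structure MemW12 {d : ℕ} (X : Set (EuclideanSpace ℝ (Fin d)))
    (m : EuclideanSpace ℝ (Fin d) → ℝ) (f : EuclideanSpace ℝ (Fin d) → ℝ) : Prop where
  aestronglyMeasurable : AEStronglyMeasurable f (law X m)
  exists_weakGradient : ∃ g, HasWeakGradient (interior X) f g
  memLp_weakGradient : MemLp (weakGradient (interior X) f) 2 ((law X m).restrict (interior X))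

/-- `W^{1,2}_0(X, μ)`: the functions of `W^{1,2}(X, μ)` vanishing at the boundary, that is, those
which are limits, in `L²(X, μ)` together with their gradients, of smooth functions with compact
support in the interior of `X`. In particular `f = 0` almost everywhere on the boundary of `X`. -/
structure MemW12Zero {d : ℕ} (X : Set (EuclideanSpace ℝ (Fin d)))
    (m : EuclideanSpace ℝ (Fin d) → ℝ) (f : EuclideanSpace ℝ (Fin d) → ℝ) : Prop where
  memW12 : MemW12 X m f
  vanishes_at_boundary : ∃ φ : ℕ → EuclideanSpace ℝ (Fin d) → ℝ,
    (∀ n, IsTestFunction (interior X) (φ n)) ∧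
    Tendsto (fun n => eLpNorm (fun x => f x - φ n x) 2 (law X m)) atTop (𝓝 0) ∧
    Tendsto (fun n => eLpNorm (fun x => weakGradient (interior X) f x - gradient (φ n) x) 2
      ((law X m).restrict (interior X))) atTop (𝓝 0)

/-- The dot product `∫ ⟨∇f, ∇g⟩ dμ` of `W^{1,2}_0(X, μ)`. -/
def sobolevInner {d : ℕ} (X : Set (EuclideanSpace ℝ (Fin d)))
    (m : EuclideanSpace ℝ (Fin d) → ℝ) (f g : EuclideanSpace ℝ (Fin d) → ℝ) : ℝ :=
  ∫ x in interior X,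
    inner ℝ (weakGradient (interior X) f x) (weakGradient (interior X) g x) ∂(law X m)

/-- The semi-norm `(∫ ‖∇f‖² dμ)^{1/2}` of `W^{1,2}_0(X, μ)`. -/
def sobolevNorm {d : ℕ} (X : Set (EuclideanSpace ℝ (Fin d)))
    (m : EuclideanSpace ℝ (Fin d) → ℝ) (f : EuclideanSpace ℝ (Fin d) → ℝ) : ℝ :=
  Real.sqrt (∫ x in interior X, ‖weakGradient (interior X) f x‖ ^ 2 ∂(law X m))

/-- The mean discrepancy `E_{x ∼ P} f(x) - E_{x ∼ Q} f(x)`, for `P = p(x) dx`, `Q = q(x) dx`. -/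
def meanDiscrepancy {d : ℕ} (X : Set (EuclideanSpace ℝ (Fin d)))
    (p q : EuclideanSpace ℝ (Fin d) → ℝ) (f : EuclideanSpace ℝ (Fin d) → ℝ) : ℝ :=
  (∫ x, f x ∂(law X p)) - ∫ x, f x ∂(law X q)

/-- The critics: functions of `W^{1,2}_0(X, μ)` whose expectations under `P` and `Q` exist. -/
def critics {d : ℕ} (X : Set (EuclideanSpace ℝ (Fin d)))
    (m p q : EuclideanSpace ℝ (Fin d) → ℝ) : Set (EuclideanSpace ℝ (Fin d) → ℝ) :=
  {f | MemW12Zero X m f ∧ Integrable f (law X p) ∧ Integrable f (law X q)}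

/-- The Sobolev IPM restricted to a class `H` of critics, as an extended real supremum. -/
def restrictedIPM {d : ℕ} (X : Set (EuclideanSpace ℝ (Fin d)))
    (m p q : EuclideanSpace ℝ (Fin d) → ℝ) (H : Set (EuclideanSpace ℝ (Fin d) → ℝ)) : EReal :=
  ⨆ f ∈ {f ∈ H | sobolevNorm X m f ≤ 1}, (meanDiscrepancy X p q f : EReal)

/-- The Sobolev IPM `S_μ(P, Q)`, where all critics are allowed. -/
def sobolevIPM {d : ℕ} (X : Set (EuclideanSpace ℝ (Fin d)))
    (m p q : EuclideanSpace ℝ (Fin d) → ℝ) : EReal :=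
  restrictedIPM X m p q (critics X m p q)

/-- `fstar` is an optimal critic: a critic in the unit ball which attains `S_μ(P, Q)`. -/
structure IsOptimalCritic {d : ℕ} (X : Set (EuclideanSpace ℝ (Fin d)))
    (m p q : EuclideanSpace ℝ (Fin d) → ℝ) (fstar : EuclideanSpace ℝ (Fin d) → ℝ) : Prop where
  mem_critics : fstar ∈ critics X m p q
  norm_le_one : sobolevNorm X m fstar ≤ 1
  attains : (meanDiscrepancy X p q fstar : EReal) = sobolevIPM X m p q

end

end SobolevIPM

/-! On critics the mean discrepancy `L` is linear and `∫ ⟨∇f, ∇g⟩ dμ` is a semi-inner product. Put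
`S = L f⋆`; it is finite because it is attained, and nonnegative because `0` is a critic. Scaling
gives `(L f)² ≤ S² ⟨f, f⟩` for every critic `f` (`meanDiscrepancy_sq_le`). At `f⋆ + t g` this is a
quadratic inequality in `t`, nearly tight at `t = 0`, so its linear term must vanish: `L g = S ⟨g,
f⋆⟩` (`meanDiscrepancy_eq`). Optimality thus replaces the Riesz theorem, and completeness plays no
role. The claim follows by pulling `S ≥ 0` out of a supremum (`coe_mul_biSup`). -/

namespace SobolevIPM

variable {d : ℕ} {X U : Set (EuclideanSpace ℝ (Fin d))}
  {m p q f g : EuclideanSpace ℝ (Fin d) → ℝ}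

/-! ### Weak gradients -/

theorem integrableOn_smul_of_tsupport_subset {E : Type*} [NormedAddCommGroup E] [NormedSpace ℝ E]
    {F : EuclideanSpace ℝ (Fin d) → E} {φ : EuclideanSpace ℝ (Fin d) → ℝ}
    (hF : LocallyIntegrableOn F U) (hφ : Continuous φ) (hc : HasCompactSupport φ)
    (hs : tsupport φ ⊆ U) : IntegrableOn (fun x => φ x • F x) U := by
  have h1 : IntegrableOn (fun x => φ x • F x) (tsupport φ) :=
    (hF.integrableOn_compact_subset hs hc).continuousOn_smul hφ.continuousOn hc
  exact (h1.integrable_of_forall_notMem_eq_zero fun x hx => by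
    simp [image_eq_zero_of_notMem_tsupport hx]).integrableOn

theorem integrableOn_mul_smul_of_tsupport_subset {E : Type*} [NormedAddCommGroup E]
    [NormedSpace ℝ E] {F : EuclideanSpace ℝ (Fin d) → E} {f : EuclideanSpace ℝ (Fin d) → ℝ}
    (hf : LocallyIntegrableOn f U) (hF : Continuous F) (hc : HasCompactSupport F)
    (hs : tsupport F ⊆ U) : IntegrableOn (fun x => f x • F x) U := by
  have h1 : IntegrableOn (fun x => f x • F x) (tsupport F) :=
    (hf.integrableOn_compact_subset hs hc).smul_continuousOn hF.continuousOn hc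
  exact (h1.integrable_of_forall_notMem_eq_zero fun x hx => by
    simp [image_eq_zero_of_notMem_tsupport hx]).integrableOn

theorem gradient_eq_toDual_symm_comp_fderiv (φ : EuclideanSpace ℝ (Fin d) → ℝ) :
    gradient φ = (InnerProductSpace.toDual ℝ (EuclideanSpace ℝ (Fin d))).symm ∘ fderiv ℝ φ := rfl

theorem IsTestFunction.continuous_gradient {φ : EuclideanSpace ℝ (Fin d) → ℝ}
    (hφ : IsTestFunction U φ) : Continuous (gradient φ) := by
  rw [gradient_eq_toDual_symm_comp_fderiv]
  exact (LinearIsometryEquiv.continuous _).comp (hφ.1.continuous_fderiv (by simp))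

theorem IsTestFunction.tsupport_gradient_subset {φ : EuclideanSpace ℝ (Fin d) → ℝ}
    (hφ : IsTestFunction U φ) : tsupport (gradient φ) ⊆ U := by
  refine (closure_mono ?_ |>.trans (tsupport_fderiv_subset ℝ (f := φ))).trans hφ.2.2
  rw [gradient_eq_toDual_symm_comp_fderiv]
  exact Function.support_comp_subset (map_zero _) _

theorem IsTestFunction.hasCompactSupport_gradient {φ : EuclideanSpace ℝ (Fin d) → ℝ}
    (hφ : IsTestFunction U φ) : HasCompactSupport (gradient φ) := by
  rw [gradient_eq_toDual_symm_comp_fderiv]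
  exact (hφ.2.1.fderiv ℝ).comp_left (map_zero _)

theorem IsTestFunction.add_smul {φ ψ : EuclideanSpace ℝ (Fin d) → ℝ} (hφ : IsTestFunction U φ)
    (hψ : IsTestFunction U ψ) (t : ℝ) : IsTestFunction U (φ + t • ψ) := by
  refine ⟨hφ.1.add (hψ.1.const_smul t), hφ.2.1.add (hψ.2.1.smul_left (f := fun _ => t)), ?_⟩
  refine (tsupport_add φ (t • ψ)).trans (union_subset hφ.2.2 ?_)
  exact (tsupport_smul_subset_right (fun _ => t) ψ).trans hψ.2.2

theorem IsTestFunction.gradient_add_smul {φ ψ : EuclideanSpace ℝ (Fin d) → ℝ}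
    (hφ : IsTestFunction U φ) (hψ : IsTestFunction U ψ) (t : ℝ) (x : EuclideanSpace ℝ (Fin d)) :
    gradient (φ + t • ψ) x = gradient φ x + t • gradient ψ x := by
  have h1 := (hφ.1.differentiable (by simp)) x
  have h2 := (hψ.1.differentiable (by simp)) x
  simp only [gradient]
  rw [fderiv_add h1 (h2.const_smul t), fderiv_const_smul h2]
  simp

/-- The difference is annihilated by all test functions, hence null by the fundamental lemma of the
calculus of variations. Since `weakGradient` is an arbitrary choice, its linearity, which holds only
almost everywhere, rests on this. -/
theorem HasWeakGradient.ae_eq {G G' : EuclideanSpace ℝ (Fin d) → EuclideanSpace ℝ (Fin d)}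
    (hU : IsOpen U) (h : HasWeakGradient U f G) (h' : HasWeakGradient U f G') :
    G =ᵐ[volume.restrict U] G' := by
  have key := hU.ae_eq_zero_of_integral_contDiff_smul_eq_zero (μ := volume)
    (h.locallyIntegrableOn_gradient.sub h'.locallyIntegrableOn_gradient) ?_
  · refine (ae_restrict_iff' hU.measurableSet).2 ?_
    filter_upwards [key] with x hx hxU
    exact sub_eq_zero.1 (hx hxU)
  · intro φ h1 h2 h3
    have e1 := h.integral_eq φ ⟨h1, h2, h3⟩
    have e2 := h'.integral_eq φ ⟨h1, h2, h3⟩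
    have e3 : ∫ x in U, φ x • G x = ∫ x in U, φ x • G' x := neg_injective (e1.symm.trans e2)
    -- The fundamental lemma integrates over the whole space, the weak gradient identity only over
    -- `U`.
    rw [← setIntegral_eq_integral_of_forall_compl_eq_zero (s := U)]
    · simp only [Pi.sub_apply, smul_sub]
      rw [integral_sub, e3, sub_self]
      · exact integrableOn_smul_of_tsupport_subset h.locallyIntegrableOn_gradient h1.continuous h2 h3
      · exact integrableOn_smul_of_tsupport_subset h'.locallyIntegrableOn_gradient
          h1.continuous h2 h3
    · intro x hx
      simp [image_eq_zero_of_notMem_tsupport fun hx' => hx (h3 hx')]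

theorem HasWeakGradient.add_smul {F G : EuclideanSpace ℝ (Fin d) → EuclideanSpace ℝ (Fin d)}
    (hf : HasWeakGradient U f F) (hg : HasWeakGradient U g G) (t : ℝ) :
    HasWeakGradient U (f + t • g) (F + t • G) where
  locallyIntegrableOn := hf.1.add (hg.1.smul t)
  locallyIntegrableOn_gradient := hf.2.add (hg.2.smul t)
  integral_eq φ hφ := by
    have hf' := integrableOn_mul_smul_of_tsupport_subset hf.1 hφ.continuous_gradient
      hφ.hasCompactSupport_gradient hφ.tsupport_gradient_subset
    have hg' := integrableOn_mul_smul_of_tsupport_subset hg.1 hφ.continuous_gradient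
      hφ.hasCompactSupport_gradient hφ.tsupport_gradient_subset
    have hF := integrableOn_smul_of_tsupport_subset hf.2 hφ.1.continuous hφ.2.1 hφ.2.2
    have hG := integrableOn_smul_of_tsupport_subset hg.2 hφ.1.continuous hφ.2.1 hφ.2.2
    have e1 : ∀ x, (f + t • g) x • gradient φ x
        = f x • gradient φ x + t • (g x • gradient φ x) := fun x => by
      simp [_root_.add_smul, mul_smul]
    have e2 : ∀ x, φ x • (F + t • G) x = φ x • F x + t • (φ x • G x) := fun x => by
      simp [smul_comm t]
    simp only [e1, e2]
    rw [integral_add hf' (by exact hg'.smul t), integral_add hF (by exact hG.smul t),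
      integral_smul, integral_smul, hf.integral_eq φ hφ, hg.integral_eq φ hφ]
    simp [add_comm]

theorem hasWeakGradient_weakGradient (h : ∃ G, HasWeakGradient U f G) :
    HasWeakGradient U f (weakGradient U f) := by
  rw [weakGradient, dif_pos h]
  exact h.choose_spec

theorem weakGradient_add_smul_ae (hU : IsOpen U) (hf : ∃ G, HasWeakGradient U f G)
    (hg : ∃ G, HasWeakGradient U g G) (t : ℝ) :
    weakGradient U (f + t • g) =ᵐ[volume.restrict U] weakGradient U f + t • weakGradient U g := by
  have h := (hasWeakGradient_weakGradient hf).add_smul (hasWeakGradient_weakGradient hg) t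
  exact (hasWeakGradient_weakGradient ⟨_, h⟩).ae_eq hU h

/-- Carries Lebesgue-a.e. identities between weak gradients over to `μ`. -/
theorem law_restrict_interior_absolutelyContinuous :
    (law X m).restrict (interior X) ≪ volume.restrict (interior X) := by
  have h : law X m ≪ volume :=
    (withDensity_absolutelyContinuous _ _).trans Measure.absolutelyContinuous_restrict
  exact h.restrict _

/-! ### The spaces `W^{1,2}` and `W^{1,2}_0` are stable under linear combinations -/

theorem MemW12.weakGradient_add_smul_ae (hf : MemW12 X m f) (hg : MemW12 X m g) (t : ℝ) :
    weakGradient (interior X) (f + t • g) =ᵐ[(law X m).restrict (interior X)]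
      weakGradient (interior X) f + t • weakGradient (interior X) g :=
  law_restrict_interior_absolutelyContinuous.ae_le
    (SobolevIPM.weakGradient_add_smul_ae isOpen_interior hf.2 hg.2 t)

theorem MemW12.add_smul (hf : MemW12 X m f) (hg : MemW12 X m g) (t : ℝ) :
    MemW12 X m (f + t • g) where
  aestronglyMeasurable := hf.1.add (hg.1.const_smul t)
  exists_weakGradient :=
    ⟨_, (hasWeakGradient_weakGradient hf.2).add_smul (hasWeakGradient_weakGradient hg.2) t⟩
  memLp_weakGradient :=
    (memLp_congr_ae (hf.weakGradient_add_smul_ae hg t)).2 (hf.3.add (hg.3.const_smul t))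

/-- Serves both the functions and their gradients in the closure of `MemW12Zero` under linear
combinations. -/
theorem tendsto_eLpNorm_add_smul {α E : Type*} [MeasurableSpace α] {μ : Measure α}
    [NormedAddCommGroup E] [NormedSpace ℝ E] {u v w : ℕ → α → E}
    (hu : ∀ n, AEStronglyMeasurable (u n) μ) (hv : ∀ n, AEStronglyMeasurable (v n) μ) (t : ℝ)
    (hw : ∀ n, w n =ᵐ[μ] u n + t • v n)
    (hu0 : Tendsto (fun n => eLpNorm (u n) 2 μ) atTop (𝓝 0))
    (hv0 : Tendsto (fun n => eLpNorm (v n) 2 μ) atTop (𝓝 0)) :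
    Tendsto (fun n => eLpNorm (w n) 2 μ) atTop (𝓝 0) := by
  have hlim : Tendsto (fun n => eLpNorm (u n) 2 μ + ‖t‖ₑ * eLpNorm (v n) 2 μ) atTop (𝓝 0) := by
    simpa using hu0.add (ENNReal.Tendsto.const_mul hv0 (Or.inr enorm_ne_top))
  refine tendsto_of_tendsto_of_tendsto_of_le_of_le tendsto_const_nhds hlim (fun _ => zero_le)
    fun n => ?_
  show eLpNorm (w n) 2 μ ≤ _
  rw [eLpNorm_congr_ae (hw n)]
  refine (eLpNorm_add_le (hu n) ((hv n).const_smul t) (by norm_num)).trans ?_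
  rw [eLpNorm_const_smul]

theorem MemW12Zero.add_smul (hf : MemW12Zero X m f) (hg : MemW12Zero X m g) (t : ℝ) :
    MemW12Zero X m (f + t • g) := by
  refine ⟨hf.1.add_smul hg.1 t, ?_⟩
  obtain ⟨φ, hφ, hφ1, hφ2⟩ := hf.2
  obtain ⟨ψ, hψ, hψ1, hψ2⟩ := hg.2
  refine ⟨fun n => φ n + t • ψ n, fun n => (hφ n).add_smul (hψ n) t,
    tendsto_eLpNorm_add_smul (fun n => hf.1.1.sub (hφ n).1.continuous.aestronglyMeasurable)
      (fun n => hg.1.1.sub (hψ n).1.continuous.aestronglyMeasurable) t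
      (fun n => .of_forall fun x => ?_) hφ1 hψ1,
    tendsto_eLpNorm_add_smul
      (fun n => hf.1.3.1.sub (hφ n).continuous_gradient.aestronglyMeasurable)
      (fun n => hg.1.3.1.sub (hψ n).continuous_gradient.aestronglyMeasurable) t
      (fun n => ?_) hφ2 hψ2⟩
  · simp only [Pi.add_apply, Pi.smul_apply, smul_eq_mul, Pi.sub_apply]
    ring
  · filter_upwards [hf.1.weakGradient_add_smul_ae hg.1 t] with x hx
    rw [hx, (hφ n).gradient_add_smul (hψ n)]
    simp only [Pi.add_apply, Pi.smul_apply, Pi.sub_apply]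
    module

theorem add_smul_mem_critics (hf : f ∈ critics X m p q) (hg : g ∈ critics X m p q) (t : ℝ) :
    f + t • g ∈ critics X m p q :=
  ⟨hf.1.add_smul hg.1 t, hf.2.1.add (hg.2.1.smul t), hf.2.2.add (hg.2.2.smul t)⟩

theorem smul_mem_critics (hf : f ∈ critics X m p q) (t : ℝ) : t • f ∈ critics X m p q := by
  have h := add_smul_mem_critics hf hf (t - 1)
  rwa [show f + (t - 1) • f = t • f by module] at h

/-! ### Bilinearity of the dot product and linearity of the mean discrepancy -/

theorem integrable_inner_weakGradient (hf : MemW12 X m f) (hg : MemW12 X m g) :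
    Integrable (fun x => inner ℝ (weakGradient (interior X) f x) (weakGradient (interior X) g x))
      ((law X m).restrict (interior X)) := by
  refine (hf.3.norm.integrable_mul hg.3.norm).mono (hf.3.1.inner hg.3.1) (.of_forall fun x => ?_)
  simpa using norm_inner_le_norm (𝕜 := ℝ) _ _

theorem sobolevInner_comm : sobolevInner X m f g = sobolevInner X m g f :=
  integral_congr_ae (.of_forall fun _ => real_inner_comm _ _)

theorem sobolevInner_add_smul_self (hf : MemW12 X m f) (hg : MemW12 X m g) (t : ℝ) :
    sobolevInner X m (f + t • g) (f + t • g) =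
      sobolevInner X m f f + 2 * t * sobolevInner X m g f + t ^ 2 * sobolevInner X m g g := by
  simp only [sobolevInner]
  rw [← integral_const_mul, ← integral_const_mul, ← integral_add, ← integral_add]
  · refine integral_congr_ae ?_
    filter_upwards [hf.weakGradient_add_smul_ae hg t] with x hx
    rw [hx]
    simp only [Pi.add_apply, Pi.smul_apply, inner_add_left, inner_add_right, inner_smul_left,
      inner_smul_right, conj_trivial]
    rw [real_inner_comm (weakGradient (interior X) g x)]
    ring
  · exact (integrable_inner_weakGradient hf hf).add
      ((integrable_inner_weakGradient hg hf).const_mul _)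
  · exact (integrable_inner_weakGradient hg hg).const_mul _
  · exact integrable_inner_weakGradient hf hf
  · exact (integrable_inner_weakGradient hg hf).const_mul _

theorem sobolevInner_smul_self (hf : MemW12 X m f) (t : ℝ) :
    sobolevInner X m (t • f) (t • f) = t ^ 2 * sobolevInner X m f f := by
  have h := sobolevInner_add_smul_self hf hf (t - 1)
  rw [show f + (t - 1) • f = t • f by module] at h
  rw [h]
  ring

theorem sobolevInner_self_nonneg : 0 ≤ sobolevInner X m f f :=
  integral_nonneg fun _ => real_inner_self_nonneg

theorem sobolevNorm_le_one_iff : sobolevNorm X m f ≤ 1 ↔ sobolevInner X m f f ≤ 1 := by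
  simp [sobolevNorm, sobolevInner, Real.sqrt_le_iff]

theorem meanDiscrepancy_add_smul (hf : f ∈ critics X m p q) (hg : g ∈ critics X m p q) (t : ℝ) :
    meanDiscrepancy X p q (f + t • g) = meanDiscrepancy X p q f + t * meanDiscrepancy X p q g := by
  simp only [meanDiscrepancy]
  rw [integral_add' hf.2.1 (hg.2.1.smul t), integral_add' hf.2.2 (hg.2.2.smul t)]
  simp only [Pi.smul_apply, smul_eq_mul, integral_const_mul]
  ring

theorem meanDiscrepancy_smul (t : ℝ) :
    meanDiscrepancy X p q (t • f) = t * meanDiscrepancy X p q f := by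
  simp only [meanDiscrepancy, Pi.smul_apply, smul_eq_mul, integral_const_mul]
  ring

/-! ### Optimal critics represent the mean discrepancy -/

theorem IsOptimalCritic.meanDiscrepancy_le {fstar : EuclideanSpace ℝ (Fin d) → ℝ}
    (h : IsOptimalCritic X m p q fstar) (hf : f ∈ critics X m p q)
    (hf1 : sobolevInner X m f f ≤ 1) :
    meanDiscrepancy X p q f ≤ meanDiscrepancy X p q fstar := by
  rw [← EReal.coe_le_coe_iff, h.attains]
  exact le_iSup₂_of_le f ⟨hf, sobolevNorm_le_one_iff.2 hf1⟩ le_rfl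

theorem IsOptimalCritic.meanDiscrepancy_nonneg {fstar : EuclideanSpace ℝ (Fin d) → ℝ}
    (h : IsOptimalCritic X m p q fstar) : 0 ≤ meanDiscrepancy X p q fstar := by
  have h0 := h.meanDiscrepancy_le (smul_mem_critics h.mem_critics 0)
    (by rw [sobolevInner_smul_self h.mem_critics.1.1]; norm_num)
  rwa [meanDiscrepancy_smul, zero_mul] at h0

/-- By homogeneity: normalise `f` and use both signs. If the seminorm of `f` is zero, all multiples
of `f` lie in the unit ball, which forces `L f = 0`. -/
theorem IsOptimalCritic.meanDiscrepancy_sq_le {fstar : EuclideanSpace ℝ (Fin d) → ℝ}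
    (h : IsOptimalCritic X m p q fstar) (hf : f ∈ critics X m p q) :
    meanDiscrepancy X p q f ^ 2 ≤
      meanDiscrepancy X p q fstar ^ 2 * sobolevInner X m f f := by
  have hscale : ∀ c : ℝ, c ^ 2 * sobolevInner X m f f ≤ 1 →
      c * meanDiscrepancy X p q f ≤ meanDiscrepancy X p q fstar := fun c hc => by
    rw [← meanDiscrepancy_smul]
    exact h.meanDiscrepancy_le (smul_mem_critics hf c)
      (by rwa [sobolevInner_smul_self hf.1.1])
  have hS := h.meanDiscrepancy_nonneg
  set S := meanDiscrepancy X p q fstar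
  set l := meanDiscrepancy X p q f
  rcases (sobolevInner_self_nonneg (X := X) (m := m) (f := f)).eq_or_lt with hb | hb
  · have hl : l = 0 := by
      by_contra hl
      -- This multiple would have discrepancy `S + 1 > S`.
      have := hscale ((S + 1) / l) (by simp [← hb])
      rw [div_mul_cancel₀ _ hl] at this
      linarith
    simp [hl, ← hb]
  · set b := sobolevInner X m f f
    have hr : 0 < √b := Real.sqrt_pos.2 hb
    have hr2 : √b ^ 2 = b := Real.sq_sqrt hb.le
    have h1 := hscale (√b)⁻¹ (by rw [inv_pow, hr2, inv_mul_cancel₀ hb.ne'])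
    have h2 := hscale (-(√b)⁻¹) (by rw [neg_sq, inv_pow, hr2, inv_mul_cancel₀ hb.ne'])
    rw [neg_mul] at h2
    rw [inv_mul_le_iff₀ hr] at h1
    rw [← mul_neg, inv_mul_le_iff₀ hr] at h2
    have h3 : |l| ≤ √b * S := abs_le'.2 ⟨h1, h2⟩
    calc l ^ 2 = |l| ^ 2 := (sq_abs l).symm
      _ ≤ (√b * S) ^ 2 := pow_le_pow_left₀ (abs_nonneg l) h3 2
      _ = S ^ 2 * b := by rw [mul_pow, hr2, mul_comm]

/-- Near `0` the linear term dominates. The choice `t = a / (1 + |b|)` is small enough whatever the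
sign of `b`. -/
theorem eq_zero_of_forall_mul_add_sq_mul_nonpos {a b : ℝ}
    (h : ∀ t : ℝ, t * a + t ^ 2 * b ≤ 0) : a = 0 := by
  by_contra ha
  have hb : 0 < 1 + |b| := by positivity
  have h1 := h (a / (1 + |b|))
  have h2 : a / (1 + |b|) * a + (a / (1 + |b|)) ^ 2 * b
      = (a / (1 + |b|)) ^ 2 * (1 + |b| + b) := by
    field_simp
  rw [h2] at h1
  have h3 : 0 < 1 + |b| + b := by linarith [neg_abs_le b]
  have h4 : 0 < (a / (1 + |b|)) ^ 2 := by positivity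
  exact absurd h1 (not_le.2 (mul_pos h4 h3))

/-- The optimal critic is, up to the factor `S_μ(P, Q)`, the Riesz representative of the mean
discrepancy. -/
theorem IsOptimalCritic.meanDiscrepancy_eq {fstar : EuclideanSpace ℝ (Fin d) → ℝ}
    (h : IsOptimalCritic X m p q fstar) (hg : g ∈ critics X m p q) :
    meanDiscrepancy X p q g =
      meanDiscrepancy X p q fstar * sobolevInner X m g fstar := by
  have hstar : sobolevInner X m fstar fstar ≤ 1 := sobolevNorm_le_one_iff.1 h.norm_le_one
  have hquad : ∀ t : ℝ, (meanDiscrepancy X p q fstar + t * meanDiscrepancy X p q g) ^ 2 ≤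
      meanDiscrepancy X p q fstar ^ 2 * (sobolevInner X m fstar fstar
        + 2 * t * sobolevInner X m g fstar + t ^ 2 * sobolevInner X m g g) := fun t => by
    rw [← meanDiscrepancy_add_smul h.mem_critics hg,
      ← sobolevInner_add_smul_self h.mem_critics.1.1 hg.1.1]
    exact h.meanDiscrepancy_sq_le (add_smul_mem_critics h.mem_critics hg t)
  have hsq := h.meanDiscrepancy_sq_le hg
  set S := meanDiscrepancy X p q fstar
  set l := meanDiscrepancy X p q g
  set a := sobolevInner X m g fstar
  set b := sobolevInner X m g g
  -- Expanding `hquad` bounds this polynomial by `S² (⟨f⋆, f⋆⟩ - 1) ≤ 0`.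
  have key := eq_zero_of_forall_mul_add_sq_mul_nonpos
    (a := 2 * S * (l - S * a)) (b := l ^ 2 - S ^ 2 * b) fun t => by
      have := hquad t
      have h2 := mul_le_mul_of_nonneg_left hstar (sq_nonneg S)
      linarith
  rcases mul_eq_zero.1 key with hS | hS
  · have hS0 : S = 0 := by linarith
    rw [hS0] at hsq ⊢
    have : l ^ 2 = 0 := le_antisymm (by simpa using hsq) (sq_nonneg l)
    simpa using this
  · linarith

/-- For `c > 0`, division by `c` inverts the scaling. Nonemptiness matters at `c = 0`: the empty
supremum is `⊥`, whereas `0 * ⊥ = 0`. -/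
theorem coe_mul_biSup {ι : Type*} {s : Set ι} (hs : s.Nonempty) {c : ℝ} (hc : 0 ≤ c)
    (u : ι → EReal) : (c : EReal) * ⨆ i ∈ s, u i = ⨆ i ∈ s, (c : EReal) * u i := by
  rcases hc.eq_or_lt with rfl | hc
  · simp [biSup_const hs]
  have hc' : (0 : EReal) < c := EReal.coe_pos.2 hc
  refine le_antisymm ?_ (iSup₂_le fun i hi =>
    mul_le_mul_of_nonneg_left (le_iSup₂_of_le i hi le_rfl) hc'.le)
  rw [mul_comm, ← EReal.le_div_iff_mul_le hc' (EReal.coe_ne_top c)]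
  refine iSup₂_le fun i hi => ?_
  rw [EReal.le_div_iff_mul_le hc' (EReal.coe_ne_top c), mul_comm]
  exact le_iSup₂_of_le (f := fun i _ => (c : EReal) * u i) i hi le_rfl

end SobolevIPM

theorem lemma1 {d : ℕ} (X : Set (EuclideanSpace ℝ (Fin d))) (hX : IsCompact X)
    (m p q : EuclideanSpace ℝ (Fin d) → ℝ)
    (hm : SobolevIPM.IsDensity X m) (hm_pos : ∀ x ∈ X, 0 < m x)
    (hp : SobolevIPM.IsDensity X p) (hq : SobolevIPM.IsDensity X q)
    (H : Set (EuclideanSpace ℝ (Fin d) → ℝ))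
    (hH : H ⊆ SobolevIPM.critics X m p q)
    (hH_ball : ∃ f ∈ H, SobolevIPM.sobolevNorm X m f ≤ 1)
    (fstar : EuclideanSpace ℝ (Fin d) → ℝ)
    (hfstar : SobolevIPM.IsOptimalCritic X m p q fstar) :
    SobolevIPM.restrictedIPM X m p q H =
      SobolevIPM.sobolevIPM X m p q *
        ⨆ f ∈ {f ∈ H | SobolevIPM.sobolevNorm X m f ≤ 1},
          (SobolevIPM.sobolevInner X m f fstar : EReal) := by
  have hne : {f ∈ H | SobolevIPM.sobolevNorm X m f ≤ 1}.Nonempty := hH_ball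
  rw [← hfstar.attains, SobolevIPM.coe_mul_biSup hne hfstar.meanDiscrepancy_nonneg,
    SobolevIPM.restrictedIPM]
  refine iSup_congr fun f => iSup_congr fun hf => ?_
  rw [hfstar.meanDiscrepancy_eq (hH hf.1), EReal.coe_mul]
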